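/- **Setting.** Let $\mathcal N$ be a finite set of agents; agent $i$ has a finite set $\mathcal S_i$ of pure strategies and mixed strategies $\mathcal X_i=\{x_i\in\mathbb R_{\ge0}^{\mathcal S_i}:\sum_{s}x_{is}=1\}$; put $\mathcal S=\prod_i\mathcal S_i$ and $\mathcal X=\prod_i\mathcal X_i$. For $i\ne j$ let $A^{(ij)}\in\mathbb R^{\mathcal S_i\times\mathcal S_j}$ be payoff matrices of a network zero-sum game, i.e. $A^{(ij)}=-[A^{(ji)}]^{\top}$. The payoff vector of agent $i$ against $x\in\mathcal X$ is $\sum_{j\ne i}A^{(ij)}x_j$, and $x^*\in\mathcal X$ is a Nash equilibrium if $\langle x_i^*,\sum_{j\ne i}A^{(ij)}x_j^*\rangle\ge\langle x_i,\sum_{j\ne i}A^{(ij)}x_j^*\rangle$ for all $i$ and all $x_i\in\mathcal X_i$. The game is *non-trivial* if there are an agent $i$ and $s,\bar s\in\mathcal S$ such that $\sum_{j\ne i}A^{(ij)}e_{s_j}-\sum_{j\ne i}A^{(ij)}e_{\bar s_j}$ is not a scalar multiple of the all-ones vector. Let $h_i:\mathcal X_i\to\mathbb R$ be strictly convex regularizers,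 $\eta_i>0$ learning rates, $h_i^*(y_i)=\sup_{x_i\in\mathcal X_i}\{\langle y_i,x_i\rangle-h_i(x_i)\}$ for $y_i\in\mathbb R^{\mathcal S_i}$, and $y^0_i\in\mathbb R^{\mathcal S_i}$ arbitrary. *Stochastic FTRL* is the process with $Y^0=y^0$, $$X_i^t=\operatorname*{arg\,max}_{x_i\in\mathcal X_i}\Big\{\langle Y_i^t,x_i\rangle-\frac{h_i(x_i)}{\eta_i}\Big\},\qquad Y_i^{t+1}=Y_i^t+\sum_{j\ne i}A^{(ij)}e_{s^t_j}\quad\text{for all } i,$$ where, conditionally on the past up to time $t$, the pure profile $s^t\in\mathcal S$ equals $s$ with probability $\prod_iX^t_{is_i}$. **Theorem.** Suppose the game is a non-trivial network zero-sum game having a Nash equilibrium $x^*$ with all $x^*_{is}$ rational and strictly positive. Suppose that for every $i$ and every $y_i\in\mathbb R^{\mathcal S_i}$ the gradient $\nabla h_i^*(y_i)$ exists and all its coordinates are strictly positive. Let $\{X^t\}_{t\ge0}$ be given by Stochastic FTRL, and let $B$ be a compact subset of the relative interior $\{x\in\mathcal X: x_{is}>0\ \text{for all } i,s\}$ of $\mathcal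 X$. Then, almost surely, $$\frac{\#\{t\in\{0,\dots,T\}:X^t\in B\}}{T+1}\longrightarrow0\qquad\text{as }T\to\infty.$$ -/

import Mathlib

open MeasureTheory ProbabilityTheory Filter Topology
open scoped Matrix

namespace NetworkGame

/-- The payoff vector `∑ j ≠ i, A^{(ij)} x_j` of agent `i` against the (mixed) profile `x`. -/
def payoff {ι : Type*} [Fintype ι] [DecidableEq ι] {S : ι → Type*} [∀ i, Fintype (S i)]
    (A : ∀ i j, Matrix (S i) (S j) ℝ) (i : ι) (x : ∀ j, S j → ℝ) : S i → ℝ :=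
  ∑ j ∈ Finset.univ.erase i, A i j *ᵥ x j

/-- The pure profile `s` as a mixed profile, `j ↦ e_{s_j}`. -/
def pureProfile {ι : Type*} {S : ι → Type*} [∀ i, DecidableEq (S i)]
    (s : ∀ j, S j) : ∀ j, S j → ℝ :=
  fun j => Pi.single (s j) 1

/-- The strategy space `𝒳 = ∏ i, 𝒳_i`, a product of probability simplices. -/
def strategySpace {ι : Type*} (S : ι → Type*) [∀ i, Fintype (S i)] : Set (∀ i, S i → ℝ) :=
  {x | ∀ i, x i ∈ stdSimplex ℝ (S i)}

/-- The fully mixed profiles, i.e. the (relative) interior of the strategy space. -/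
def fullyMixed {ι : Type*} (S : ι → Type*) [∀ i, Fintype (S i)] : Set (∀ i, S i → ℝ) :=
  {x | x ∈ strategySpace S ∧ ∀ i s, 0 < x i s}

/-- Network zero-sum games: `A^{(ij)} = -[A^{(ji)}]ᵀ` for distinct agents. -/
def IsZeroSum {ι : Type*} {S : ι → Type*} (A : ∀ i j, Matrix (S i) (S j) ℝ) : Prop :=
  ∀ i j, i ≠ j → A i j = -(A j i)ᵀ

/-- Some agent `i` has two profiles whose payoff vectors differ by something other than
a multiple of the all-ones vector: the payoff differences between her own pure strategies
depend on what the other agents play. -/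
def IsNontrivial {ι : Type*} [Fintype ι] [DecidableEq ι] {S : ι → Type*} [∀ i, Fintype (S i)]
    [∀ i, DecidableEq (S i)] (A : ∀ i j, Matrix (S i) (S j) ℝ) : Prop :=
  ∃ (i : ι) (s s' : ∀ j, S j), ∀ c : ℝ,
    payoff A i (pureProfile s) - payoff A i (pureProfile s') ≠ fun _ => c

/-- `x` is a Nash equilibrium. -/
def IsNash {ι : Type*} [Fintype ι] [DecidableEq ι] {S : ι → Type*} [∀ i, Fintype (S i)]
    (A : ∀ i j, Matrix (S i) (S j) ℝ) (x : ∀ i, S i → ℝ) : Prop :=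
  x ∈ strategySpace S ∧
    ∀ i, ∀ z ∈ stdSimplex ℝ (S i), z ⬝ᵥ payoff A i x ≤ x i ⬝ᵥ payoff A i x

/-- Convex conjugate `h*(y) = sup_{x ∈ Δ} (⟨y, x⟩ - h x)` of a regularizer on the simplex. -/
noncomputable def conjugate {α : Type*} [Fintype α] (h : (α → ℝ) → ℝ) (y : α → ℝ) : ℝ :=
  sSup ((fun x => y ⬝ᵥ x - h x) '' stdSimplex ℝ α)

/-- `∇h*(y)` exists and is strictly positive in every coordinate, for every `y`. -/
def GradConjugatePos {α : Type*} [Fintype α] [DecidableEq α] (h : (α → ℝ) → ℝ) : Prop :=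
  ∀ y : α → ℝ, DifferentiableAt ℝ (conjugate h) y ∧
    ∀ s : α, 0 < fderiv ℝ (conjugate h) y (Pi.single s 1)

/-- Stochastic FTRL with game `A`, regularizers `h`, learning rates `η` and initial payoff
vectors `y₀`. `act t` is the pure profile realized in iteration `t`: given the past `ℱ t`, the
agents draw their pure strategies independently, agent `i` from the distribution `X t i`. -/
structure IsStochasticFTRL {ι : Type*} [Fintype ι] [DecidableEq ι] {S : ι → Type*}
    [∀ i, Fintype (S i)] [∀ i, DecidableEq (S i)] {Ω : Type*} {m : MeasurableSpace Ω}
    (μ : Measure Ω) (ℱ : Filtration ℕ m)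
    (A : ∀ i j, Matrix (S i) (S j) ℝ) (h : ∀ i, (S i → ℝ) → ℝ) (η : ι → ℝ)
    (y₀ : ∀ i, S i → ℝ) (act : ℕ → Ω → ∀ i, S i) (Y X : ℕ → Ω → ∀ i, S i → ℝ) : Prop where
  /-- the profile drawn in iteration `t` is known at time `t + 1` -/
  measurable_act : ∀ t σ, MeasurableSet[ℱ (t + 1)] {ω | act t ω = σ}
  initial : ∀ ω, Y 0 ω = y₀
  update : ∀ t ω i, Y (t + 1) ω i = Y t ω i + payoff A i (pureProfile (act t ω))
  /-- `X t i` lies in the simplex and maximizes `⟨Y t i, x⟩ - h i x / η i` there -/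
  mem_simplex : ∀ t ω i, X t ω i ∈ stdSimplex ℝ (S i)
  isMaxOn : ∀ t ω i,
    IsMaxOn (fun x => Y t ω i ⬝ᵥ x - h i x / η i) (stdSimplex ℝ (S i)) (X t ω i)
  cond_law : ∀ t (σ : ∀ i, S i),
    μ[Set.indicator {ω | act t ω = σ} (fun _ => (1 : ℝ)) | ℱ t]
      =ᵐ[μ] fun ω => ∏ i, X t ω i (σ i)

/-- The fraction of the iterations `t = 0, …, T` with `x t ∈ B`. -/
noncomputable def visitFraction {E : Type*} (B : Set E) (x : ℕ → E) (T : ℕ) : ℝ :=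
  (∑ t ∈ Finset.range (T + 1), B.indicator (fun _ => (1 : ℝ)) (x t)) / ((T : ℝ) + 1)

end NetworkGame

/-! The cumulative payoffs form a Markov chain, and the reaction is a function of its state, the
gradient of the conjugates. Let `F` be the Fenchel coupling with the equilibrium. Skew-symmetry,
together with the indifference of all agents at a fully mixed equilibrium, makes the first-order
terms of `F` cancel in expectation. What remains of the one-step drift is a mean of Bregman
divergences, hence nonnegative (`transition_fenchelCoupling_sub`).

The conjugates may have affine pieces, so this drift can vanish. If, however, the drift over `n`
steps vanished at `y`, then, since every profile has positive probability, the reaction would not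
change along `y, y + Δσ, …, y + n Δσ`. For a profile `σ` giving some agent a nonconstant payoff
vector, the coordinates of that agent's argument drift apart linearly, whereas a reaction bounded
away from the boundary keeps them within a fixed distance (`exists_abs_sub_le`). Hence for large `n`
the drift is positive (`exists_transition_pow_drift_pos`). It is even uniformly positive, because
modulo constants the relevant states form a compact set.

Since `F` is unbounded, it is replaced by `K arctan (F / K)`, which keeps the drift up to an error
of order `1 / K` (`drift_arctan_le`). For a bounded function the time average of the `n`-step drift
tends to zero by the law of large numbers for martingale differences. This bounds the limiting
frequency of visits by a multiple of `1 / K`, and `K` is arbitrary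
(`ae_tendsto_visitFraction_chain`). -/

namespace NetworkGame

/-! ### Law of large numbers for bounded martingale differences -/

section MartingaleDifferences

variable {Ω : Type*} {m : MeasurableSpace Ω} {μ : Measure Ω} [IsProbabilityMeasure μ]
  {ℱ : Filtration ℕ m} {d : ℕ → Ω → ℝ} {C : ℝ}

/-- The variance of a sum of bounded martingale differences grows at most linearly. -/
theorem integral_sq_sum_le_of_martingaleDifference
    (hmeas : ∀ t, StronglyMeasurable[ℱ (t + 1)] (d t)) (hbdd : ∀ t ω, |d t ω| ≤ C)
    (hcond : ∀ t, μ[d t | ℱ t] =ᵐ[μ] 0) (T : ℕ) :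
    ∫ ω, (∑ t ∈ Finset.range T, d t ω) ^ 2 ∂μ ≤ T * C ^ 2 := by
  have hdm : ∀ t, StronglyMeasurable (d t) := fun t => (hmeas t).mono (ℱ.le _)
  have hC : 0 ≤ C := by
    obtain ⟨ω⟩ : Nonempty Ω := μ.nonempty_of_neZero
    exact (abs_nonneg _).trans (hbdd 0 ω)
  have hsum_bdd : ∀ T ω, |∑ t ∈ Finset.range T, d t ω| ≤ T * C := fun T ω => by
    calc |∑ t ∈ Finset.range T, d t ω| ≤ ∑ t ∈ Finset.range T, |d t ω| :=
          Finset.abs_sum_le_sum_abs _ _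
      _ ≤ ∑ t ∈ Finset.range T, C := Finset.sum_le_sum fun t _ => hbdd t ω
      _ = T * C := by simp
  have hsum_meas : ∀ T, StronglyMeasurable[ℱ T] (fun ω => ∑ t ∈ Finset.range T, d t ω) := by
    intro T
    refine Finset.stronglyMeasurable_fun_sum _ fun t ht => (hmeas t).mono (ℱ.mono ?_)
    have := Finset.mem_range.1 ht
    omega
  have hint : ∀ {f : Ω → ℝ} (K : ℝ), StronglyMeasurable f → (∀ ω, |f ω| ≤ K) → Integrable f μ :=
    fun K hf hK => Integrable.of_bound hf.aestronglyMeasurable K (.of_forall hK)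
  induction T with
  | zero => simp
  | succ T ih =>
    have hS := (hsum_meas T).mono (ℱ.le T)
    have hcross : Integrable (fun ω => (∑ t ∈ Finset.range T, d t ω) * d T ω) μ := by
      refine hint (T * C * C) (hS.mul (hdm T)) fun ω => ?_
      rw [abs_mul]
      exact mul_le_mul (hsum_bdd T ω) (hbdd T ω) (abs_nonneg _) (by positivity)
    -- Orthogonality of increments: the earlier sum is known at time `T` and leaves the conditional
    -- expectation.
    have hcross_zero : ∫ ω, (∑ t ∈ Finset.range T, d t ω) * d T ω ∂μ = 0 := by
      rw [← integral_condExp (ℱ.le T)]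
      have h1 : μ[fun ω => (∑ t ∈ Finset.range T, d t ω) * d T ω | ℱ T] =ᵐ[μ]
          (fun ω => ∑ t ∈ Finset.range T, d t ω) * μ[d T | ℱ T] :=
        condExp_mul_of_stronglyMeasurable_left (hsum_meas T) hcross
          (hint C (hdm T) (hbdd T))
      have h2 : μ[fun ω => (∑ t ∈ Finset.range T, d t ω) * d T ω | ℱ T] =ᵐ[μ] 0 := by
        filter_upwards [h1, hcond T] with ω h h'
        rw [h, Pi.mul_apply, h']
        simp
      rw [integral_congr_ae h2]
      simp
    have hsq : Integrable (fun ω => (∑ t ∈ Finset.range T, d t ω) ^ 2) μ := by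
      refine hint ((T * C) ^ 2) (hS.pow 2) fun ω => ?_
      rw [abs_pow]
      exact pow_le_pow_left₀ (abs_nonneg _) (hsum_bdd T ω) 2
    have hdsq_le : ∀ ω, d T ω ^ 2 ≤ C ^ 2 := fun ω => sq_le_sq' (abs_le.1 (hbdd T ω)).1
      (abs_le.1 (hbdd T ω)).2
    have hdsq : Integrable (fun ω => d T ω ^ 2) μ :=
      hint (C ^ 2) ((hdm T).pow 2) fun ω => by rw [abs_of_nonneg (sq_nonneg _)]; exact hdsq_le ω
    have hle : ∫ ω, d T ω ^ 2 ∂μ ≤ C ^ 2 := by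
      calc ∫ ω, d T ω ^ 2 ∂μ ≤ ∫ _, C ^ 2 ∂μ :=
            integral_mono hdsq (integrable_const _) hdsq_le
        _ = C ^ 2 := by simp
    calc ∫ ω, (∑ t ∈ Finset.range (T + 1), d t ω) ^ 2 ∂μ
        = ∫ ω, (((∑ t ∈ Finset.range T, d t ω) ^ 2
            + 2 * ((∑ t ∈ Finset.range T, d t ω) * d T ω)) + d T ω ^ 2) ∂μ := by
          congr 1 with ω
          rw [Finset.sum_range_succ]
          ring
      _ = ∫ ω, (∑ t ∈ Finset.range T, d t ω) ^ 2 ∂μ + 2 * 0 + ∫ ω, d T ω ^ 2 ∂μ := by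
          have hadd : Integrable (fun ω => (∑ t ∈ Finset.range T, d t ω) ^ 2
              + 2 * ((∑ t ∈ Finset.range T, d t ω) * d T ω)) μ := hsq.add (hcross.const_mul 2)
          rw [integral_add hadd hdsq, integral_add hsq (hcross.const_mul 2), integral_const_mul,
            hcross_zero]
      _ ≤ (T + 1 : ℕ) * C ^ 2 := by push_cast; linarith

/-- Strong law of large numbers for bounded martingale differences. -/
theorem ae_tendsto_average_of_martingaleDifference
    (hmeas : ∀ t, StronglyMeasurable[ℱ (t + 1)] (d t)) (hbdd : ∀ t ω, |d t ω| ≤ C)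
    (hcond : ∀ t, μ[d t | ℱ t] =ᵐ[μ] 0) :
    ∀ᵐ ω ∂μ, Tendsto (fun T : ℕ => (∑ t ∈ Finset.range T, d t ω) / T) atTop (𝓝 0) := by
  have hdm : ∀ t, StronglyMeasurable (d t) := fun t => (hmeas t).mono (ℱ.le _)
  have hC : 0 ≤ C := by
    obtain ⟨ω⟩ : Nonempty Ω := μ.nonempty_of_neZero
    exact (abs_nonneg _).trans (hbdd 0 ω)
  -- Along the squares the second moments of the averages are at most `C ^ 2 / (n + 1) ^ 2`, which
  -- is summable.
  set c : ℕ → ℕ := fun n => (n + 1) ^ 2 with hc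
  have hcpos : ∀ n, (0 : ℝ) < c n := fun n => by simp only [hc]; positivity
  set q : ℕ → Ω → ℝ := fun n ω => ((∑ t ∈ Finset.range (c n), d t ω) / c n) ^ 2 with hq
  have hqm : ∀ n, StronglyMeasurable (q n) := fun n =>
    ((Measurable.div_const (Finset.measurable_fun_sum _ fun t _ => (hdm t).measurable)
      _).pow_const 2).stronglyMeasurable
  have hqint : ∀ n, Integrable (q n) μ := fun n => by
    refine Integrable.of_bound (hqm n).aestronglyMeasurable (C ^ 2) (.of_forall fun ω => ?_)
    rw [Real.norm_eq_abs, abs_of_nonneg (sq_nonneg _)]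
    refine sq_le_sq.2 ?_
    rw [abs_div, abs_of_pos (hcpos n), abs_of_nonneg hC, div_le_iff₀ (hcpos n)]
    calc |∑ t ∈ Finset.range (c n), d t ω| ≤ ∑ t ∈ Finset.range (c n), |d t ω| :=
          Finset.abs_sum_le_sum_abs _ _
      _ ≤ ∑ t ∈ Finset.range (c n), C := Finset.sum_le_sum fun t _ => hbdd t ω
      _ = C * c n := by simp [mul_comm]
  have hqle : ∀ n, ∫⁻ ω, ENNReal.ofReal (q n ω) ∂μ ≤ ENNReal.ofReal (C ^ 2 / (n + 1) ^ 2) := by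
    intro n
    rw [← ofReal_integral_eq_lintegral_ofReal (hqint n) (.of_forall fun ω => sq_nonneg _)]
    refine ENNReal.ofReal_le_ofReal ?_
    have h1 := integral_sq_sum_le_of_martingaleDifference hmeas hbdd hcond (c n)
    simp only [hq, div_pow]
    rw [integral_div, div_le_iff₀ (by have := hcpos n; positivity)]
    refine h1.trans (le_of_eq ?_)
    simp only [hc]
    push_cast
    field_simp
  have hfin : ∑' n : ℕ, ENNReal.ofReal (C ^ 2 / ((n : ℝ) + 1) ^ 2) ≠ ⊤ := by
    refine Summable.tsum_ofReal_ne_top ?_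
    have := ((Real.summable_nat_pow_inv (p := 2)).2 (by norm_num)).comp_injective
      (add_left_injective 1)
    refine (this.mul_left (C ^ 2)).congr fun n => ?_
    simp [div_eq_mul_inv]
  have hae : ∀ᵐ ω ∂μ, ∑' n, ENNReal.ofReal (q n ω) < ⊤ := by
    refine ae_lt_top (Measurable.tsum fun n => (hqm n).measurable.ennreal_ofReal) ?_
    rw [lintegral_tsum fun n => (hqm n).measurable.ennreal_ofReal.aemeasurable]
    exact ne_top_of_le_ne_top hfin (ENNReal.tsum_le_tsum hqle)
  filter_upwards [hae] with ω hω
  have hq0 : Tendsto (fun n => q n ω) atTop (𝓝 0) := by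
    have h1 := ENNReal.tendsto_atTop_zero_of_tsum_ne_top hω.ne
    have h2 := (ENNReal.tendsto_toReal ENNReal.zero_ne_top).comp h1
    simpa [Function.comp_def, ENNReal.toReal_ofReal, hq, sq_nonneg] using h2
  have hsub : Tendsto (fun n => (∑ t ∈ Finset.range (c n), d t ω) / c n) atTop (𝓝 0) := by
    rw [tendsto_zero_iff_abs_tendsto_zero]
    have := hq0.sqrt
    simpa [hq, Real.sqrt_sq_eq_abs, Function.comp_def] using this
  -- Shifting by `C` makes the partial sums monotone. As ratios of consecutive squares tend to one,
  -- convergence along the squares then extends to all times, with limit `C` instead of zero.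
  have hmono : Monotone fun T : ℕ => ∑ t ∈ Finset.range T, (d t ω + C) := by
    refine monotone_nat_of_le_succ fun T => ?_
    rw [Finset.sum_range_succ]
    linarith [(abs_le.1 (hbdd T ω)).1]
  have hcast : ∀ T : ℕ, ∑ t ∈ Finset.range T, (d t ω + C)
      = ∑ t ∈ Finset.range T, d t ω + T * C := fun T => by
    simp [Finset.sum_add_distrib]
  have hctop : Tendsto c atTop atTop :=
    tendsto_atTop_mono (fun n => by simp only [hc, id]; nlinarith) tendsto_id
  have hlim := tendsto_div_of_monotone_of_exists_subseq_tendsto_div _ C hmono fun a ha => by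
    refine ⟨c, ?_, hctop, ?_⟩
    · have hr : Tendsto (fun n : ℕ => (1 + 1 / ((n : ℝ) + 1)) ^ 2) atTop (𝓝 1) := by
        have := (tendsto_one_div_add_atTop_nhds_zero_nat (𝕜 := ℝ)).const_add 1
        simpa using this.pow 2
      filter_upwards [hr.eventually (eventually_lt_nhds ha)] with n hn
      have : (c (n + 1) : ℝ) = (1 + 1 / ((n : ℝ) + 1)) ^ 2 * c n := by
        simp only [hc]
        push_cast
        field_simp
      rw [this]
      exact mul_le_mul_of_nonneg_right hn.le (hcpos n).le
    · have := hsub.add_const C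
      rw [zero_add] at this
      refine this.congr fun n => ?_
      rw [hcast, add_div, mul_div_cancel_left₀ _ (hcpos n).ne']
  have := hlim.sub_const C
  rw [sub_self] at this
  refine this.congr' ?_
  filter_upwards [eventually_gt_atTop 0] with T hT
  have hT' : (T : ℝ) ≠ 0 := by positivity
  rw [hcast, add_div, mul_div_cancel_left₀ _ hT']
  ring

end MartingaleDifferences

/-! ### Transition operators and the drift of truncated functions -/

section Kernel

variable {V : Type*} [AddCommGroup V] {P : Type*} [Fintype P]

/-- The transition operator of the Markov chain that moves from `y` to `y + Δ σ` with
probability `w y σ`. -/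
def transition (w : V → P → ℝ) (Δ : P → V) : Module.End ℝ (V → ℝ) where
  toFun g y := ∑ σ, w y σ * g (y + Δ σ)
  map_add' f g := by
    ext y
    simp [mul_add, Finset.sum_add_distrib]
  map_smul' c g := by
    ext y
    simp only [Pi.smul_apply, smul_eq_mul, RingHom.id_apply, Finset.mul_sum]
    exact Finset.sum_congr rfl fun σ _ => by ring

variable {w : V → P → ℝ} {Δ : P → V}

theorem transition_apply (g : V → ℝ) (y : V) :
    transition w Δ g y = ∑ σ, w y σ * g (y + Δ σ) := rfl

theorem transition_pow_succ_apply (n : ℕ) (g : V → ℝ) (y : V) :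
    (transition w Δ ^ (n + 1)) g y = ∑ σ, w y σ * (transition w Δ ^ n) g (y + Δ σ) := by
  rw [pow_succ', Module.End.mul_apply, transition_apply]

theorem transition_pow_mono (hw : ∀ y σ, 0 ≤ w y σ) (n : ℕ) {f g : V → ℝ} (hfg : ∀ y, f y ≤ g y)
    (y : V) : (transition w Δ ^ n) f y ≤ (transition w Δ ^ n) g y := by
  induction n generalizing y with
  | zero => simpa using hfg y
  | succ n ih =>
    rw [transition_pow_succ_apply, transition_pow_succ_apply]
    exact Finset.sum_le_sum fun σ _ => mul_le_mul_of_nonneg_left (ih _) (hw y σ)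

theorem transition_pow_const (hw1 : ∀ y, ∑ σ, w y σ = 1) (n : ℕ) (c : ℝ) (y : V) :
    (transition w Δ ^ n) (fun _ => c) y = c := by
  induction n generalizing y with
  | zero => simp
  | succ n ih =>
    rw [transition_pow_succ_apply]
    simp [ih, ← Finset.sum_mul, hw1]

theorem abs_transition_pow_le (hw : ∀ y σ, 0 ≤ w y σ) (hw1 : ∀ y, ∑ σ, w y σ = 1) {g : V → ℝ}
    {C : ℝ} (hg : ∀ y, |g y| ≤ C) (n : ℕ) (y : V) : |(transition w Δ ^ n) g y| ≤ C := by
  rw [abs_le]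
  constructor
  · rw [← transition_pow_const (Δ := Δ) hw1 n (-C) y]
    exact transition_pow_mono hw n (fun z => (abs_le.1 (hg z)).1) y
  · rw [← transition_pow_const (Δ := Δ) hw1 n C y]
    exact transition_pow_mono hw n (fun z => (abs_le.1 (hg z)).2) y

/-- If a nonnegative function has mean zero after `k` steps, it vanishes at every point that can be
reached in `k` steps, in particular at the one reached by repeating the same step. -/
theorem eq_zero_of_transition_pow_eq_zero (hw : ∀ y σ, 0 < w y σ) {g : V → ℝ} (hg : ∀ y, 0 ≤ g y)
    (σ : P) (k : ℕ) (y : V) (h : (transition w Δ ^ k) g y = 0) : g (y + k • Δ σ) = 0 := by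
  have hnonneg : ∀ k y, 0 ≤ (transition w Δ ^ k) g y := fun k y => by
    have := transition_pow_mono (w := w) (Δ := Δ) (fun y σ => (hw y σ).le) k (f := 0) hg y
    simpa using this
  induction k generalizing y with
  | zero => simpa using h
  | succ k ih =>
    rw [transition_pow_succ_apply, Finset.sum_eq_zero_iff_of_nonneg
      fun σ _ => mul_nonneg (hw y σ).le (hnonneg k _)] at h
    have := ih _ ((mul_eq_zero.1 (h σ (Finset.mem_univ _))).resolve_left (hw y σ).ne')
    rwa [add_assoc, ← succ_nsmul'] at this

/-- Telescoping. If the one-step drift is nonnegative, the `n`-step drift vanishes only if every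
summand does. -/
theorem transition_pow_sub_eq_sum (g : V → ℝ) (n : ℕ) (y : V) :
    (transition w Δ ^ n) g y - g y
      = ∑ k ∈ Finset.range n, (transition w Δ ^ k) (transition w Δ g - g) y := by
  induction n with
  | zero => simp
  | succ n ih =>
    rw [Finset.sum_range_succ, ← ih, map_sub, pow_succ, Module.End.mul_apply, Pi.sub_apply]
    ring

/-- A first order expansion of `arctan` with quadratic error. -/
theorem arctan_add_div_sub_sq_le (a b : ℝ) :
    Real.arctan a + (b - a) / (1 + a ^ 2) - (b - a) ^ 2 ≤ Real.arctan b := by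
  have hlip : ∀ u v : ℝ, |1 / (1 + u ^ 2) - 1 / (1 + v ^ 2)| ≤ |u - v| := fun u v => by
    have hu : 0 < 1 + u ^ 2 := by positivity
    have hv : 0 < 1 + v ^ 2 := by positivity
    rw [div_sub_div _ _ hu.ne' hv.ne', abs_div, abs_of_pos (mul_pos hu hv),
      div_le_iff₀ (mul_pos hu hv),
      show 1 * (1 + v ^ 2) - (1 + u ^ 2) * 1 = (u - v) * (-(u + v)) by ring, abs_mul]
    -- What is left is `|u + v| ≤ (1 + u ^ 2) * (1 + v ^ 2)`.
    refine mul_le_mul_of_nonneg_left ?_ (abs_nonneg _)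
    rw [abs_neg, abs_le]
    constructor <;>
    nlinarith [sq_nonneg (u - 1), sq_nonneg (v - 1), sq_nonneg (u + 1), sq_nonneg (v + 1),
      mul_nonneg (sq_nonneg u) (sq_nonneg v)]
  rcases lt_trichotomy a b with hab | rfl | hab
  · obtain ⟨c, hc, h⟩ := exists_hasDerivAt_eq_slope Real.arctan (fun x => 1 / (1 + x ^ 2)) hab
      Real.continuous_arctan.continuousOn (fun x _ => Real.hasDerivAt_arctan x)
    have h1 := abs_le.1 (hlip c a)
    rw [abs_of_pos (sub_pos.2 hc.1)] at h1
    rw [eq_div_iff (sub_pos.2 hab).ne'] at h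
    have h2 : 1 / (1 + a ^ 2) - (b - a) ≤ 1 / (1 + c ^ 2) := by linarith [h1.1, hc.2]
    have h3 := mul_le_mul_of_nonneg_right h2 (sub_pos.2 hab).le
    rw [h] at h3
    have : (b - a) / (1 + a ^ 2) = 1 / (1 + a ^ 2) * (b - a) := by ring
    rw [this]
    nlinarith
  · simp
  · obtain ⟨c, hc, h⟩ := exists_hasDerivAt_eq_slope Real.arctan (fun x => 1 / (1 + x ^ 2)) hab
      Real.continuous_arctan.continuousOn (fun x _ => Real.hasDerivAt_arctan x)
    have h1 := abs_le.1 (hlip c a)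
    rw [abs_of_neg (sub_neg.2 hc.2)] at h1
    rw [eq_div_iff (sub_pos.2 hab).ne'] at h
    have h2 : 1 / (1 + c ^ 2) ≤ 1 / (1 + a ^ 2) + (a - b) := by linarith [h1.2, hc.1]
    have h3 := mul_le_mul_of_nonneg_right h2 (sub_pos.2 hab).le
    rw [h] at h3
    have : (b - a) / (1 + a ^ 2) = -(1 / (1 + a ^ 2) * (a - b)) := by ring
    rw [this]
    nlinarith

/-- Along every path `F` moves by at most `L` per step. The level `a` is kept separate from `F y`
because the starting point moves in the induction. -/
theorem transition_pow_sq_sub_le (hw : ∀ y σ, 0 ≤ w y σ) (hw1 : ∀ y, ∑ σ, w y σ = 1) {F : V → ℝ}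
    {L : ℝ} (hF : ∀ y σ, |F (y + Δ σ) - F y| ≤ L) (a : ℝ) (n : ℕ) (y : V) :
    (transition w Δ ^ n) (fun z => (F z - a) ^ 2) y ≤ (|F y - a| + n * L) ^ 2 := by
  induction n generalizing y with
  | zero => simp
  | succ n ih =>
    rw [transition_pow_succ_apply]
    calc ∑ σ, w y σ * (transition w Δ ^ n) (fun z => (F z - a) ^ 2) (y + Δ σ)
        ≤ ∑ σ, w y σ * (|F y - a| + (n + 1 : ℕ) * L) ^ 2 := by
          refine Finset.sum_le_sum fun σ _ => mul_le_mul_of_nonneg_left ?_ (hw y σ)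
          have hL : 0 ≤ L := (abs_nonneg _).trans (hF y σ)
          refine (ih _).trans (pow_le_pow_left₀ (by positivity) ?_ 2)
          have h1 : |F (y + Δ σ) - a| ≤ |F (y + Δ σ) - F y| + |F y - a| := abs_sub_le _ _ _
          push_cast
          linarith [hF y σ]
      _ = _ := by rw [← Finset.sum_mul, hw1, one_mul]

/-- The bounded function `K arctan (F / K)` inherits the upward drift of `F`, up to an error of
order `1 / K`. -/
theorem drift_arctan_le (hw : ∀ y σ, 0 ≤ w y σ) (hw1 : ∀ y, ∑ σ, w y σ = 1) {F : V → ℝ}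
    {L : ℝ} (hF : ∀ y σ, |F (y + Δ σ) - F y| ≤ L) {K : ℝ} (hK : 0 < K) (n : ℕ) (y : V) :
    ((transition w Δ ^ n) F y - F y) / (1 + (F y / K) ^ 2) - (n * L) ^ 2 / K
      ≤ (transition w Δ ^ n) (fun z => K * Real.arctan (F z / K)) y
        - K * Real.arctan (F y / K) := by
  set c : ℝ := 1 / (1 + (F y / K) ^ 2) with hc
  -- The arctan expansion at `F y`, arranged as a linear combination of functions of `z` to which
  -- the operator applies term by term.
  have hpt : ∀ z, ((fun _ : V => K * Real.arctan (F y / K) - c * F y) + c • F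
      - (1 / K) • fun z => (F z - F y) ^ 2) z ≤ K * Real.arctan (F z / K) := fun z => by
    have h := mul_le_mul_of_nonneg_left (arctan_add_div_sub_sq_le (F y / K) (F z / K)) hK.le
    refine le_trans (le_of_eq ?_) h
    simp only [Pi.add_apply, Pi.sub_apply, Pi.smul_apply, smul_eq_mul, hc]
    have : 0 < 1 + (F y / K) ^ 2 := by positivity
    rw [← sub_div]
    field_simp
    ring
  have h := transition_pow_mono (Δ := Δ) hw n hpt y
  rw [map_sub, map_add, map_smul, map_smul, Pi.sub_apply, Pi.add_apply, Pi.smul_apply,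
    Pi.smul_apply, transition_pow_const hw1, smul_eq_mul, smul_eq_mul] at h
  have hsq := transition_pow_sq_sub_le hw hw1 hF (F y) n y
  rw [sub_self, abs_zero, zero_add] at hsq
  have hsq' := mul_le_mul_of_nonneg_left hsq (one_div_pos.2 hK).le
  have e1 : ((transition w Δ ^ n) F y - F y) / (1 + (F y / K) ^ 2)
      = c * (transition w Δ ^ n) F y - c * F y := by rw [hc]; ring
  have e2 : (n * L) ^ 2 / K = 1 / K * (n * L) ^ 2 := by ring
  rw [e1, e2]
  linarith

end Kernel

/-! ### Occupation times of a Markov chain -/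

section Chain

variable {V : Type*} [AddCommGroup V] {P : Type*} [Fintype P] {w : V → P → ℝ} {Δ : P → V}
  {Ω : Type*} {m : MeasurableSpace Ω} {μ : Measure Ω} [IsProbabilityMeasure μ]
  {ℱ : Filtration ℕ m} {y₀ : V} {act : ℕ → Ω → P} {Y : ℕ → Ω → V}

/-- At each time the chain takes finitely many values, so the state space needs no σ-algebra and `U`
may be any set. -/
theorem measurableSet_preimage_chain
    (hact : ∀ t σ, MeasurableSet[ℱ (t + 1)] {ω | act t ω = σ}) (h0 : ∀ ω, Y 0 ω = y₀)
    (hY : ∀ t ω, Y (t + 1) ω = Y t ω + Δ (act t ω)) (t : ℕ) (U : Set V) :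
    MeasurableSet[ℱ t] {ω | Y t ω ∈ U} := by
  induction t generalizing U with
  | zero => simp [h0]
  | succ t ih =>
    have : {ω | Y (t + 1) ω ∈ U}
        = ⋃ σ, {ω | act t ω = σ} ∩ {ω | Y t ω ∈ {y | y + Δ σ ∈ U}} := by
      ext ω
      simp [hY]
    rw [this]
    exact MeasurableSet.iUnion fun σ => (hact t σ).inter (ℱ.mono (Nat.le_succ t) _ (ih _))

theorem stronglyMeasurable_comp_chain
    (hact : ∀ t σ, MeasurableSet[ℱ (t + 1)] {ω | act t ω = σ}) (h0 : ∀ ω, Y 0 ω = y₀)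
    (hY : ∀ t ω, Y (t + 1) ω = Y t ω + Δ (act t ω)) (t : ℕ) (g : V → ℝ) :
    StronglyMeasurable[ℱ t] fun ω => g (Y t ω) :=
  Measurable.stronglyMeasurable fun U _ => measurableSet_preimage_chain hact h0 hY t (g ⁻¹' U)

/-- The Markov property. -/
theorem condExp_comp_chain
    (hact : ∀ t σ, MeasurableSet[ℱ (t + 1)] {ω | act t ω = σ}) (h0 : ∀ ω, Y 0 ω = y₀)
    (hY : ∀ t ω, Y (t + 1) ω = Y t ω + Δ (act t ω))
    (hlaw : ∀ t σ, μ[Set.indicator {ω | act t ω = σ} (fun _ => (1 : ℝ)) | ℱ t]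
      =ᵐ[μ] fun ω => w (Y t ω) σ)
    {g : V → ℝ} {C : ℝ} (hg : ∀ y, |g y| ≤ C) (t : ℕ) :
    μ[fun ω => g (Y (t + 1) ω) | ℱ t] =ᵐ[μ] fun ω => transition w Δ g (Y t ω) := by
  have hind : ∀ σ, Integrable (Set.indicator {ω | act t ω = σ} (fun _ => (1 : ℝ))) μ := fun σ =>
    (integrable_const _).indicator (ℱ.le _ _ (hact t σ))
  have hmeas : ∀ σ, StronglyMeasurable[ℱ t] fun ω => g (Y t ω + Δ σ) := fun σ =>
    stronglyMeasurable_comp_chain hact h0 hY t fun y => g (y + Δ σ)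
  have hint : ∀ σ, Integrable ((fun ω => g (Y t ω + Δ σ)) *
      Set.indicator {ω | act t ω = σ} (fun _ => (1 : ℝ))) μ := fun σ =>
    (hind σ).bdd_mul ((hmeas σ).mono (ℱ.le t)).aestronglyMeasurable (.of_forall fun ω => hg _)
  have hdecomp : (fun ω => g (Y (t + 1) ω)) = ∑ σ, (fun ω => g (Y t ω + Δ σ)) *
      Set.indicator {ω | act t ω = σ} (fun _ => (1 : ℝ)) := by
    ext ω
    rw [Finset.sum_apply, Finset.sum_eq_single (act t ω)]
    · simp [hY]
    · intro σ _ hσ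
      simp [Set.indicator, hσ.symm]
    · simp
  rw [hdecomp]
  have hpull : ∀ σ, μ[(fun ω => g (Y t ω + Δ σ)) *
      Set.indicator {ω | act t ω = σ} (fun _ => (1 : ℝ)) | ℱ t]
      =ᵐ[μ] fun ω => g (Y t ω + Δ σ) * w (Y t ω) σ := fun σ => by
    filter_upwards [condExp_mul_of_stronglyMeasurable_left (hmeas σ) (hint σ) (hind σ), hlaw t σ]
      with ω h1 h2
    rw [h1, Pi.mul_apply, h2]
  filter_upwards [condExp_finsetSum (s := Finset.univ) (fun σ _ => hint σ) (ℱ t),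
    ae_all_iff.2 hpull] with ω h1 h2
  rw [h1, Finset.sum_apply, transition_apply]
  exact Finset.sum_congr rfl fun σ _ => by rw [h2, mul_comm]

/-- Along almost every trajectory, the time average of `Pⁿ g - g` tends to zero, for every bounded
function `g`. -/
theorem ae_tendsto_average_transition_pow_sub (hw : ∀ y σ, 0 ≤ w y σ)
    (hw1 : ∀ y, ∑ σ, w y σ = 1)
    (hact : ∀ t σ, MeasurableSet[ℱ (t + 1)] {ω | act t ω = σ}) (h0 : ∀ ω, Y 0 ω = y₀)
    (hY : ∀ t ω, Y (t + 1) ω = Y t ω + Δ (act t ω))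
    (hlaw : ∀ t σ, μ[Set.indicator {ω | act t ω = σ} (fun _ => (1 : ℝ)) | ℱ t]
      =ᵐ[μ] fun ω => w (Y t ω) σ)
    {g : V → ℝ} {C : ℝ} (hg : ∀ y, |g y| ≤ C) (n : ℕ) :
    ∀ᵐ ω ∂μ, Tendsto (fun T : ℕ =>
      (∑ t ∈ Finset.range T, ((transition w Δ ^ n) g (Y t ω) - g (Y t ω))) / T) atTop (𝓝 0) := by
  induction n with
  | zero => simp
  | succ n ih =>
    set f := (transition w Δ ^ n) g with hf
    have hfC : ∀ y, |f y| ≤ C := abs_transition_pow_le hw hw1 hg n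
    have hfC' : ∀ y, |transition w Δ f y| ≤ C := fun y => by
      simpa using abs_transition_pow_le (Δ := Δ) hw hw1 hfC 1 y
    have hm : ∀ t (φ : V → ℝ), StronglyMeasurable[ℱ t] fun ω => φ (Y t ω) :=
      stronglyMeasurable_comp_chain hact h0 hY
    have hint : ∀ t {φ : V → ℝ}, (∀ y, |φ y| ≤ C) → Integrable (fun ω => φ (Y t ω)) μ :=
      fun t φ hφ => Integrable.of_bound ((hm t φ).mono (ℱ.le t)).aestronglyMeasurable C
        (.of_forall fun ω => hφ _)
    -- With `P` the transition operator and `f = P ^ n g`, the new term `P f - f` at `Y t` is the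
    -- telescoping increment `f (Y (t + 1)) - f (Y t)` minus this martingale difference.
    have hslln := ae_tendsto_average_of_martingaleDifference (μ := μ) (ℱ := ℱ) (C := C + C)
      (d := fun t ω => f (Y (t + 1) ω) - transition w Δ f (Y t ω))
      (fun t => (hm (t + 1) f).sub ((hm t _).mono (ℱ.mono (Nat.le_succ t))))
      (fun t ω => (abs_sub _ _).trans (add_le_add (hfC _) (hfC' _))) (fun t => by
        have h1 := condExp_sub (hint (t + 1) hfC) (hint t hfC') (ℱ t)
        have h2 := condExp_comp_chain hact h0 hY hlaw hfC t
        have h3 := condExp_of_stronglyMeasurable (ℱ.le t) (hm t (transition w Δ f)) (hint t hfC')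
        filter_upwards [h1, h2] with ω h1 h2
        refine h1.trans ?_
        rw [Pi.sub_apply, h2, h3]
        simp)
    filter_upwards [ih, hslln] with ω h1 h2
    have h3 : Tendsto (fun T : ℕ => (f (Y T ω) - f (Y 0 ω)) / T) atTop (𝓝 0) := by
      refine squeeze_zero_norm (a := fun T : ℕ => (C + C) / T) (fun T => ?_)
        (tendsto_const_div_atTop_nhds_zero_nat _)
      rw [norm_div, Real.norm_natCast]
      exact div_le_div_of_nonneg_right ((abs_sub _ _).trans (add_le_add (hfC _) (hfC _)))
        (Nat.cast_nonneg _)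
    have h4 := (h1.add h3).sub h2
    rw [add_zero, sub_zero] at h4
    refine h4.congr fun T => ?_
    rw [← Finset.sum_range_sub (fun t => f (Y t ω)), ← add_div, ← sub_div,
      ← Finset.sum_add_distrib, ← Finset.sum_sub_distrib]
    congr 1
    refine Finset.sum_congr rfl fun t _ => ?_
    rw [pow_succ', Module.End.mul_apply]
    ring

/-- If `F` has bounded increments along a Markov chain and nonnegative drift over `n` steps, then
the chain spends asymptotically no time in a set on which `F` is bounded and its drift is bounded
away from zero. -/
theorem ae_tendsto_visitFraction_chain (hw : ∀ y σ, 0 ≤ w y σ)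
    (hw1 : ∀ y, ∑ σ, w y σ = 1)
    (hact : ∀ t σ, MeasurableSet[ℱ (t + 1)] {ω | act t ω = σ}) (h0 : ∀ ω, Y 0 ω = y₀)
    (hY : ∀ t ω, Y (t + 1) ω = Y t ω + Δ (act t ω))
    (hlaw : ∀ t σ, μ[Set.indicator {ω | act t ω = σ} (fun _ => (1 : ℝ)) | ℱ t]
      =ᵐ[μ] fun ω => w (Y t ω) σ)
    {F : V → ℝ} {L : ℝ} (hF : ∀ y σ, |F (y + Δ σ) - F y| ≤ L) {n : ℕ}
    (hdrift : ∀ y, F y ≤ (transition w Δ ^ n) F y) {U : Set V} {δ M : ℝ} (hδ : 0 < δ)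
    (hM : ∀ y ∈ U, |F y| ≤ M) (hU : ∀ y ∈ U, δ ≤ (transition w Δ ^ n) F y - F y) :
    ∀ᵐ ω ∂μ, Tendsto (fun T : ℕ => visitFraction U (fun t => Y t ω) T) atTop (𝓝 0) := by
  -- Countably many truncation levels `k + 1` share one null set.
  have hae := ae_all_iff.2 fun k : ℕ =>
    ae_tendsto_average_transition_pow_sub (μ := μ) hw hw1 hact h0 hY hlaw
      (g := fun z => ((k : ℝ) + 1) * Real.arctan (F z / (k + 1)))
      (C := ((k : ℝ) + 1) * (Real.pi / 2)) (fun y => by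
        rw [abs_mul, abs_of_pos (by positivity : (0 : ℝ) < k + 1)]
        exact mul_le_mul_of_nonneg_left (abs_le.2 ⟨(Real.neg_pi_div_two_lt_arctan _).le,
          (Real.arctan_lt_pi_div_two _).le⟩) (by positivity)) n
  filter_upwards [hae] with ω hω
  -- On `U` the slope of the truncation is at least `1 / (1 + M ^ 2)` at every level `k + 1 ≥ 1`, so
  -- this bound does not depend on `k`.
  set c : ℝ := δ / (1 + M ^ 2) with hc
  have hcpos : 0 < c := by positivity
  have hpt : ∀ (k : ℕ) (y : V), c * U.indicator (fun _ => (1 : ℝ)) y - (n * L) ^ 2 / (k + 1)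
      ≤ (transition w Δ ^ n) (fun z => ((k : ℝ) + 1) * Real.arctan (F z / (k + 1))) y
        - ((k : ℝ) + 1) * Real.arctan (F y / (k + 1)) := fun k y => by
    have hk : (0 : ℝ) < k + 1 := by positivity
    refine le_trans (sub_le_sub_right ?_ _) (drift_arctan_le hw hw1 hF hk n y)
    by_cases hy : y ∈ U
    · rw [Set.indicator_of_mem hy, mul_one, hc]
      refine div_le_div₀ (sub_nonneg.2 (hdrift y)) (hU y hy) (by positivity) ?_
      have h1 : |F y / (k + 1)| ≤ M := by
        rw [abs_div, abs_of_pos hk, div_le_iff₀ hk]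
        nlinarith [hM y hy, abs_nonneg (F y), (Nat.cast_nonneg k : (0 : ℝ) ≤ k)]
      have h2 := sq_le_sq' (abs_le.1 h1).1 (abs_le.1 h1).2
      linarith
    · rw [Set.indicator_of_notMem hy, mul_zero]
      exact div_nonneg (sub_nonneg.2 (hdrift y)) (by positivity)
  have hnonneg : ∀ T, 0 ≤ visitFraction U (fun t => Y t ω) T := fun T =>
    div_nonneg (Finset.sum_nonneg fun t _ => Set.indicator_nonneg (fun _ _ => zero_le_one) _)
      (by positivity)
  rw [tendsto_order]
  refine ⟨fun a ha => .of_forall fun T => ha.trans_le (hnonneg T), fun a ha => ?_⟩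
  -- Half of `a * c` absorbs the truncation error; the other half is left for the time average.
  obtain ⟨k, hk⟩ := exists_nat_gt ((n * L) ^ 2 / (a * c / 2))
  have hk1 : (0 : ℝ) < k + 1 := by positivity
  have herr : (n * L) ^ 2 / (k + 1) < a * c / 2 := by
    rw [div_lt_iff₀ hk1]
    rw [div_lt_iff₀ (by positivity)] at hk
    nlinarith [mul_pos ha hcpos]
  have hev := ((hω k).comp (tendsto_add_atTop_nat 1)).eventually
    (eventually_lt_nhds (half_pos (mul_pos ha hcpos)))
  filter_upwards [hev] with T hT
  have hT1 : (0 : ℝ) < (T : ℝ) + 1 := by positivity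
  simp only [Function.comp_apply, Nat.cast_add, Nat.cast_one] at hT
  have hsum := Finset.sum_le_sum fun t (_ : t ∈ Finset.range (T + 1)) => hpt k (Y t ω)
  rw [Finset.sum_sub_distrib, ← Finset.mul_sum, Finset.sum_const, Finset.card_range,
    nsmul_eq_mul] at hsum
  rw [div_lt_iff₀ hT1] at hT
  have hfin : c * ∑ t ∈ Finset.range (T + 1), U.indicator (fun _ => (1 : ℝ)) (Y t ω)
      < c * (a * ((T : ℝ) + 1)) := by
    push_cast at hsum
    nlinarith
  unfold visitFraction
  rw [div_lt_iff₀ hT1]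
  exact lt_of_mul_lt_mul_left hfin hcpos.le

end Chain

/-! ### Conjugates of regularizers and their gradients -/

section Potential

variable {α : Type*} [Fintype α]

/-- `H` is a finite convex function on `α → ℝ` whose gradient `g` maps into the interior of the
simplex; the properties listed are those that the conjugate of a regularizer has. -/
structure IsSimplexPotential (H : (α → ℝ) → ℝ) (g : (α → ℝ) → α → ℝ) : Prop where
  pos : ∀ y s, 0 < g y s
  sum_eq_one : ∀ y, ∑ s, g y s = 1
  subgradient : ∀ y z, H y + g y ⬝ᵥ (z - y) ≤ H z
  eq_of_subgradient : ∀ y p, (∀ z, H y + p ⬝ᵥ (z - y) ≤ H z) → p = g y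
  add_const : ∀ y c, H (y + fun _ => c) = H y + c
  growth : ∃ C, ∀ y s, y s ≤ H y + C

theorem abs_dotProduct_le_of_mem_stdSimplex {x : α → ℝ} (hx : x ∈ stdSimplex ℝ α) (v : α → ℝ) :
    |x ⬝ᵥ v| ≤ ‖v‖ := by
  calc |∑ s, x s * v s| ≤ ∑ s, |x s * v s| := Finset.abs_sum_le_sum_abs _ _
    _ ≤ ∑ s, x s * ‖v‖ := by
        refine Finset.sum_le_sum fun s _ => ?_
        rw [abs_mul, abs_of_nonneg (hx.1 s)]
        exact mul_le_mul_of_nonneg_left (norm_le_pi_norm v s) (hx.1 s)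
    _ = ‖v‖ := by rw [← Finset.sum_mul, hx.2, one_mul]

theorem dotProduct_add_const_of_mem_stdSimplex {x : α → ℝ} (hx : x ∈ stdSimplex ℝ α)
    (y : α → ℝ) (c : ℝ) : (y + fun _ => c) ⬝ᵥ x = y ⬝ᵥ x + c := by
  rw [add_dotProduct]
  congr 1
  simp [dotProduct, ← Finset.mul_sum, hx.2]

namespace IsSimplexPotential

variable {H : (α → ℝ) → ℝ} {g : (α → ℝ) → α → ℝ}

theorem mem_stdSimplex (hH : IsSimplexPotential H g) (y : α → ℝ) : g y ∈ stdSimplex ℝ α :=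
  ⟨fun s => (hH.pos y s).le, hH.sum_eq_one y⟩

theorem abs_sub_le (hH : IsSimplexPotential H g) (y z : α → ℝ) : |H z - H y| ≤ ‖z - y‖ := by
  have h1 := hH.subgradient y z
  have h2 := hH.subgradient z y
  have h3 := abs_le.1 (abs_dotProduct_le_of_mem_stdSimplex (hH.mem_stdSimplex y) (z - y))
  have h4 := abs_le.1 (abs_dotProduct_le_of_mem_stdSimplex (hH.mem_stdSimplex z) (y - z))
  rw [norm_sub_rev y z] at h4
  rw [abs_le]
  constructor <;> linarith [h3.1, h4.1]

theorem continuous (hH : IsSimplexPotential H g) : Continuous H := by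
  refine (LipschitzWith.of_dist_le_mul (K := 1) fun y z => ?_).continuous
  rw [NNReal.coe_one, one_mul, Real.dist_eq, dist_eq_norm]
  exact hH.abs_sub_le z y

/-- The gradient of a differentiable convex function is continuous. -/
theorem continuous_gradient (hH : IsSimplexPotential H g) : Continuous g := by
  rw [continuous_iff_continuousAt]
  intro y
  have hK : IsCompact (stdSimplex ℝ α) := isCompact_stdSimplex ℝ α
  -- The simplex is compact, so it suffices that each cluster point of the gradients is a
  -- subgradient at `y`; subgradient inequalities survive limits.
  refine hK.tendsto_nhds_of_unique_mapClusterPt (.of_forall hH.mem_stdSimplex) fun p _ hp => ?_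
  refine hH.eq_of_subgradient y p fun z => ?_
  obtain ⟨U, hU, hUp⟩ := mapClusterPt_iff_ultrafilter.1 hp
  have hUy : Tendsto (fun x => x) (U : Filter (α → ℝ)) (𝓝 y) := hU
  have hlim : Tendsto (fun x => H x + g x ⬝ᵥ (z - x)) U (𝓝 (H y + p ⬝ᵥ (z - y))) :=
    ((hH.continuous.tendsto y).comp hUy).add
      (((Continuous.dotProduct continuous_fst continuous_snd).tendsto (p, z - y)).comp
        (hUp.prodMk_nhds (hUy.const_sub z)))
  exact le_of_tendsto hlim (.of_forall fun x => hH.subgradient x z)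

theorem gradient_add_const (hH : IsSimplexPotential H g) (y : α → ℝ) (c : ℝ) :
    g (y + fun _ => c) = g y := by
  refine hH.eq_of_subgradient _ _ fun z => ?_
  have h1 := hH.subgradient (y + fun _ => c) (z + fun _ => c)
  rwa [hH.add_const, hH.add_const, add_sub_add_right_eq_sub, add_right_comm,
    add_le_add_iff_right] at h1

/-- A supporting affine function at `y` that also touches the graph at `y + v` supports it there,
and subgradients are unique. -/
theorem gradient_eq_of_affine (hH : IsSimplexPotential H g) {y v : α → ℝ}
    (h : H (y + v) = H y + g y ⬝ᵥ v) : g (y + v) = g y := by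
  refine (hH.eq_of_subgradient _ _ fun z => ?_).symm
  have h1 := hH.subgradient y z
  rwa [h, add_assoc, ← dotProduct_add, show v + (z - (y + v)) = z - y by abel]

/-- Where the gradient is bounded away from the boundary of the simplex, the coordinates of the
argument differ by a bounded amount. -/
theorem exists_abs_sub_le (hH : IsSimplexPotential H g) {ε : ℝ} (hε : 0 < ε) :
    ∃ R, ∀ y, (∀ s, ε ≤ g y s) → ∀ s s', |y s - y s'| ≤ R := by
  obtain ⟨C, hC⟩ := hH.growth
  have hone : ∀ y, (∀ s, ε ≤ g y s) → ∀ s s', y s - y s' ≤ (H 0 + C) / ε := by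
    intro y hy s s'
    obtain ⟨s₀, -, hs₀⟩ := Finset.exists_max_image Finset.univ y ⟨s, Finset.mem_univ s⟩
    have hs₀' : ∀ r, y r ≤ y s₀ := fun r => hs₀ r (Finset.mem_univ r)
    -- This gives `H y ≤ H 0 + g y ⬝ᵥ y`. With the growth bound at the maximal coordinate, the mean
    -- gap to the maximum is at most `H 0 + C`, and each single gap has weight at least `ε`.
    have h1 := hH.subgradient y 0
    rw [zero_sub, dotProduct_neg] at h1
    have h2 : ∑ r, g y r * (y s₀ - y r) = y s₀ - g y ⬝ᵥ y := by
      simp [mul_sub, Finset.sum_sub_distrib, ← Finset.sum_mul, hH.sum_eq_one, dotProduct]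
    have h3 : g y s' * (y s₀ - y s') ≤ ∑ r, g y r * (y s₀ - y r) :=
      Finset.single_le_sum (f := fun r => g y r * (y s₀ - y r))
        (fun r _ => mul_nonneg (hH.pos y r).le (sub_nonneg.2 (hs₀' r))) (Finset.mem_univ s')
    have h4 := mul_le_mul_of_nonneg_right (hy s') (sub_nonneg.2 (hs₀' s'))
    rw [le_div_iff₀ hε]
    have h5 := hC y s₀
    have h6 := mul_le_mul_of_nonneg_left (hs₀' s) hε.le
    nlinarith
  refine ⟨(H 0 + C) / ε, fun y hy s s' => abs_le.2 ⟨?_, hone y hy s s'⟩⟩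
  linarith [hone y hy s' s]

/-- Passing to the learning rate `η`. -/
theorem scale (hH : IsSimplexPotential H g) {η : ℝ} (hη : 0 < η) :
    IsSimplexPotential (fun y => H (η • y) / η) (fun y => g (η • y)) where
  pos y s := hH.pos _ s
  sum_eq_one y := hH.sum_eq_one _
  subgradient y z := by
    have h := hH.subgradient (η • y) (η • z)
    rw [← smul_sub, dotProduct_smul, smul_eq_mul] at h
    rw [div_add' _ _ _ hη.ne', div_le_div_iff_of_pos_right hη]
    linarith
  eq_of_subgradient y p hp := by
    refine hH.eq_of_subgradient _ _ fun z => ?_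
    have h := hp (η⁻¹ • z)
    rw [smul_inv_smul₀ hη.ne', div_add' _ _ _ hη.ne', div_le_div_iff_of_pos_right hη,
      mul_comm, ← smul_eq_mul, ← dotProduct_smul, smul_sub, smul_inv_smul₀ hη.ne'] at h
    exact h
  add_const y c := by
    have : η • (y + fun _ => c) = η • y + fun _ => η * c := by
      ext s
      simp [mul_add]
    rw [this, hH.add_const]
    field_simp
  growth := by
    obtain ⟨C, hC⟩ := hH.growth
    refine ⟨C / η, fun y s => ?_⟩
    have := hC (η • y) s
    rw [← add_div, le_div_iff₀ hη]
    simpa [mul_comm] using this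

end IsSimplexPotential

variable {h : (α → ℝ) → ℝ}

/-- Changing `y` alters the values by a bounded amount, so unboundedness for one `y` means
unboundedness for all. The real `sSup` would then be its default `0` everywhere, contradicting the
positive derivative. -/
theorem bddAbove_conjugate [DecidableEq α] [Nonempty α] (hh : GradConjugatePos h) (y : α → ℝ) :
    BddAbove ((fun x => y ⬝ᵥ x - h x) '' stdSimplex ℝ α) := by
  by_contra hy
  have hall : ∀ z, ¬ BddAbove ((fun x => z ⬝ᵥ x - h x) '' stdSimplex ℝ α) := by
    rintro z ⟨b, hb⟩
    refine hy ⟨b + ‖y - z‖, ?_⟩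
    rintro _ ⟨x, hx, rfl⟩
    have h1 := hb ⟨x, hx, rfl⟩
    have h2 := abs_le.1 (abs_dotProduct_le_of_mem_stdSimplex hx (y - z))
    rw [dotProduct_comm, sub_dotProduct] at h2
    dsimp only at h1 ⊢
    linarith [h2.2]
  have hzero : conjugate h = fun _ => 0 := funext fun z => Real.sSup_of_not_bddAbove (hall z)
  have := (hh 0).2 (Classical.arbitrary α)
  rw [hzero] at this
  simp at this

/-- The conjugate of a regularizer, with its gradient. -/
theorem isSimplexPotential_conjugate [DecidableEq α] [Nonempty α] (hh : GradConjugatePos h) :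
    IsSimplexPotential (conjugate h)
      (fun y s => fderiv ℝ (conjugate h) y (Pi.single s 1)) := by
  have hle : ∀ y, ∀ x ∈ stdSimplex ℝ α, y ⬝ᵥ x - h x ≤ conjugate h y := fun y x hx =>
    le_csSup (bddAbove_conjugate hh y) ⟨x, hx, rfl⟩
  have hne : ∀ y, ((fun x => y ⬝ᵥ x - h x) '' stdSimplex ℝ α).Nonempty := fun y =>
    Set.Nonempty.image _ ⟨_, single_mem_stdSimplex ℝ (Classical.arbitrary α)⟩
  have hconj_le : ∀ y b, (∀ x ∈ stdSimplex ℝ α, y ⬝ᵥ x - h x ≤ b) → conjugate h y ≤ b := by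
    intro y b hb
    refine csSup_le (hne y) ?_
    rintro _ ⟨x, hx, rfl⟩
    exact hb x hx
  have hadd_le : ∀ y c, conjugate h (y + fun _ => c) ≤ conjugate h y + c := fun y c =>
    hconj_le _ _ fun x hx => by
      rw [dotProduct_add_const_of_mem_stdSimplex hx]
      linarith [hle y x hx]
  have hadd : ∀ y c, conjugate h (y + fun _ => c) = conjugate h y + c := fun y c => by
    refine le_antisymm (hadd_le y c) ?_
    have h1 := hadd_le (y + fun _ => c) (-c)
    have h2 : (y + fun _ : α => c) + (fun _ => -c) = y := by
      ext s
      simp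
    rw [h2] at h1
    linarith
  have hconvex : ConvexOn ℝ Set.univ (conjugate h) := by
    refine ⟨convex_univ, fun y _ z _ a b ha hb hab => hconj_le _ _ fun x hx => ?_⟩
    have h1 := mul_le_mul_of_nonneg_left (hle y x hx) ha
    have h2 := mul_le_mul_of_nonneg_left (hle z x hx) hb
    rw [add_dotProduct, smul_dotProduct, smul_dotProduct]
    simp only [smul_eq_mul]
    have h3 : h x = (a + b) * h x := by rw [hab, one_mul]
    rw [h3]
    linarith
  have hfd : ∀ y v : α → ℝ, fderiv ℝ (conjugate h) y v
      = (fun s => fderiv ℝ (conjugate h) y (Pi.single s 1)) ⬝ᵥ v := fun y v => by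
    conv_lhs => rw [← Finset.univ_sum_single v, map_sum]
    refine Finset.sum_congr rfl fun s _ => ?_
    have : Pi.single s (v s) = v s • (Pi.single s 1 : α → ℝ) := by
      rw [← Pi.single_smul, smul_eq_mul, mul_one]
    rw [this, map_smul, smul_eq_mul, mul_comm]
  have hline : ∀ y v : α → ℝ, HasDerivAt (fun t : ℝ => conjugate h (y + t • v))
      (fderiv ℝ (conjugate h) y v) 0 := fun y v => by
    have h1 : HasDerivAt (fun t : ℝ => y + t • v) v 0 := by
      simpa using ((hasDerivAt_id (0 : ℝ)).smul_const v).const_add y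
    have h2 : HasFDerivAt (conjugate h) (fderiv ℝ (conjugate h) y) (y + (0 : ℝ) • v) := by
      simpa using (hh y).1.hasFDerivAt
    exact h2.comp_hasDerivAt (0 : ℝ) h1
  have hsub : ∀ y z, conjugate h y + (fun s => fderiv ℝ (conjugate h) y (Pi.single s 1)) ⬝ᵥ (z - y)
      ≤ conjugate h z := fun y z => by
    rw [← hfd]
    have h1 : ConvexOn ℝ Set.univ (fun t : ℝ => conjugate h (y + t • (z - y))) := by
      have := hconvex.comp_affineMap (AffineMap.lineMap y z : ℝ →ᵃ[ℝ] (α → ℝ))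
      rw [Set.preimage_univ] at this
      convert! this using 2 with t
      simp [AffineMap.lineMap_apply, add_comm]
    have h2 := h1.le_slope_of_hasDerivAt (Set.mem_univ 0) (Set.mem_univ 1) zero_lt_one
      (hline y (z - y))
    simp only [slope, sub_zero, inv_one, one_smul, zero_smul, add_zero, vsub_eq_sub,
      add_sub_cancel] at h2
    linarith
  refine ⟨fun y s => (hh y).2 s, fun y => ?_, hsub, fun y p hp => ?_, hadd, ?_⟩
  -- Translating by `1` and by `-1` bounds the sum of the gradient from both sides.
  · have h1 := hsub y (y + fun _ => 1)
    have h2 := hsub y (y + fun _ => -1)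
    rw [hadd, add_sub_cancel_left] at h1 h2
    simp only [dotProduct, mul_one, mul_neg, Finset.sum_neg_distrib] at h1 h2
    linarith
  · ext s
    have h1 : HasDerivAt (fun t : ℝ => conjugate h (y + t • Pi.single s 1) - t * p s)
        (fderiv ℝ (conjugate h) y (Pi.single s 1) - 1 * p s) 0 :=
      (hline y (Pi.single s 1)).sub ((hasDerivAt_id (0 : ℝ)).mul_const (p s))
    have h2 : IsLocalMin (fun t : ℝ => conjugate h (y + t • Pi.single s 1) - t * p s) 0 := by
      refine .of_forall fun t => ?_
      have h3 := hp (y + t • Pi.single s 1)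
      rw [add_sub_cancel_left, dotProduct_smul, dotProduct_single_one, smul_eq_mul] at h3
      simp only [zero_smul, add_zero, zero_mul, sub_zero]
      linarith
    have h4 := h2.hasDerivAt_eq_zero h1
    linarith
  · obtain ⟨s₀, -, hs₀⟩ := Finset.exists_max_image Finset.univ (fun s => h (Pi.single s 1))
      Finset.univ_nonempty
    refine ⟨h (Pi.single s₀ 1), fun y s => ?_⟩
    have h1 := hle y _ (single_mem_stdSimplex ℝ s)
    have h2 := hs₀ s (Finset.mem_univ s)
    rw [dotProduct_single_one] at h1
    linarith

/-- A maximizer of `⟨y, x⟩ - h x / η` is the gradient of the conjugate at `η y`. -/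
theorem eq_gradient_conjugate_of_isMaxOn [DecidableEq α] [Nonempty α] (hh : GradConjugatePos h)
    {η : ℝ} (hη : 0 < η) {y x : α → ℝ} (hx : x ∈ stdSimplex ℝ α)
    (hmax : IsMaxOn (fun x => y ⬝ᵥ x - h x / η) (stdSimplex ℝ α) x) :
    x = fun s => fderiv ℝ (conjugate h) (η • y) (Pi.single s 1) := by
  refine (isSimplexPotential_conjugate hh).eq_of_subgradient _ _ fun z => ?_
  have h1 : conjugate h (η • y) ≤ (η • y) ⬝ᵥ x - h x := by
    refine csSup_le (Set.Nonempty.image _ ⟨x, hx⟩) ?_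
    rintro _ ⟨x', hx', rfl⟩
    have h2 := mul_le_mul_of_nonneg_left (hmax hx') hη.le
    dsimp only at h2 ⊢
    rw [mul_sub, mul_sub, mul_div_cancel₀ _ hη.ne', mul_div_cancel₀ _ hη.ne'] at h2
    rwa [smul_dotProduct, smul_dotProduct, smul_eq_mul, smul_eq_mul]
  have h3 : z ⬝ᵥ x - h x ≤ conjugate h z := le_csSup (bddAbove_conjugate hh z) ⟨x, hx, rfl⟩
  rw [dotProduct_sub, dotProduct_comm x z, dotProduct_comm x]
  linarith

end Potential

/-! ### Zero-sum structure and fully mixed equilibria -/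

section Game

variable {ι : Type*} [Fintype ι] [DecidableEq ι] {S : ι → Type*} [∀ i, Fintype (S i)]
  {A : ∀ i j, Matrix (S i) (S j) ℝ}

theorem payoff_sum_smul {P : Type*} [Fintype P] (i : ι) (c : P → ℝ) (z : P → ∀ j, S j → ℝ) :
    payoff A i (∑ σ, c σ • z σ) = ∑ σ, c σ • payoff A i (z σ) := by
  simp only [payoff, Finset.sum_apply, Pi.smul_apply, Matrix.mulVec_sum, Matrix.mulVec_smul,
    Finset.smul_sum]
  exact Finset.sum_comm

/-- In a network zero-sum game the total payoff is a skew-symmetric bilinear form. -/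
theorem IsZeroSum.sum_dotProduct_payoff (hA : IsZeroSum A) (u v : ∀ i, S i → ℝ) :
    ∑ i, u i ⬝ᵥ payoff A i v = -∑ i, v i ⬝ᵥ payoff A i u := by
  -- The diagonal blocks `A i i` are unconstrained and absent from the payoffs, hence the zero.
  have hexp : ∀ u v : ∀ i, S i → ℝ, ∑ i, u i ⬝ᵥ payoff A i v
      = ∑ i, ∑ j, if i = j then 0 else u i ⬝ᵥ (A i j *ᵥ v j) := fun u v => by
    refine Finset.sum_congr rfl fun i _ => ?_
    rw [payoff, dotProduct_sum, ← Finset.add_sum_erase _ _ (Finset.mem_univ i), if_pos rfl,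
      zero_add]
    exact Finset.sum_congr rfl fun j hj => (if_neg (Finset.ne_of_mem_erase hj).symm).symm
  rw [hexp, hexp, Finset.sum_comm, ← Finset.sum_neg_distrib]
  refine Finset.sum_congr rfl fun j _ => ?_
  rw [← Finset.sum_neg_distrib]
  refine Finset.sum_congr rfl fun i _ => ?_
  by_cases hij : i = j
  · simp [hij]
  · rw [if_neg hij, if_neg (Ne.symm hij), hA i j hij, Matrix.neg_mulVec, dotProduct_neg,
      Matrix.mulVec_transpose, dotProduct_comm, ← Matrix.dotProduct_mulVec]

/-- Against a fully mixed equilibrium all strategies of an agent have the same payoff. -/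
theorem IsNash.dotProduct_payoff_eq [∀ i, DecidableEq (S i)] {xstar : ∀ i, S i → ℝ}
    (hN : IsNash A xstar) (hpos : ∀ i s, 0 < xstar i s) (i : ι) {x : S i → ℝ}
    (hx : x ∈ stdSimplex ℝ (S i)) : x ⬝ᵥ payoff A i xstar = xstar i ⬝ᵥ payoff A i xstar := by
  set c := xstar i ⬝ᵥ payoff A i xstar with hc
  have hle : ∀ s, payoff A i xstar s ≤ c := fun s => by
    have := hN.2 i _ (single_mem_stdSimplex ℝ s)
    rwa [single_one_dotProduct] at this
  have hsum : ∑ s, xstar i s * (c - payoff A i xstar s) = 0 := by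
    simp only [mul_sub, Finset.sum_sub_distrib, ← Finset.sum_mul, (hN.1 i).2, one_mul]
    rw [hc, dotProduct, sub_self]
  have heq : ∀ s, payoff A i xstar s = c := fun s => by
    have := (Finset.sum_eq_zero_iff_of_nonneg fun s _ =>
      mul_nonneg (hpos i s).le (sub_nonneg.2 (hle s))).1 hsum s (Finset.mem_univ s)
    have := (mul_eq_zero.1 this).resolve_left (hpos i s).ne'
    linarith
  simp only [dotProduct, heq, ← Finset.sum_mul, hx.2, one_mul]

/-- Skew-symmetry kills the term of `x` against itself and turns the other one into minus the payoff
of `x` against `xstar`. By indifference this equals that of `xstar` against itself, which is zero.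
-/
theorem IsZeroSum.sum_sub_dotProduct_payoff_eq_zero [∀ i, DecidableEq (S i)] (hA : IsZeroSum A)
    {xstar : ∀ i, S i → ℝ} (hN : IsNash A xstar) (hpos : ∀ i s, 0 < xstar i s)
    {x : ∀ i, S i → ℝ} (hx : x ∈ strategySpace S) :
    ∑ i, (x i - xstar i) ⬝ᵥ payoff A i x = 0 := by
  have h1 := hA.sum_dotProduct_payoff x x
  have h2 := hA.sum_dotProduct_payoff xstar x
  have h3 := hA.sum_dotProduct_payoff xstar xstar
  have h4 : ∑ i, x i ⬝ᵥ payoff A i xstar = ∑ i, xstar i ⬝ᵥ payoff A i xstar :=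
    Finset.sum_congr rfl fun i _ => hN.dotProduct_payoff_eq hpos i (hx i)
  simp only [sub_dotProduct, Finset.sum_sub_distrib]
  linarith

theorem sum_prod_eq_one {x : ∀ i, S i → ℝ} (hx : x ∈ strategySpace S) :
    ∑ σ : ∀ i, S i, ∏ i, x i (σ i) = 1 := by
  rw [← Fintype.prod_sum]
  exact Finset.prod_eq_one fun i _ => (hx i).2

/-- The expectation of the realized pure profile is the mixed profile. -/
theorem sum_prod_smul_pureProfile [∀ i, DecidableEq (S i)] {x : ∀ i, S i → ℝ}
    (hx : x ∈ strategySpace S) :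
    ∑ σ : ∀ i, S i, (∏ i, x i (σ i)) • pureProfile σ = x := by
  ext j s
  -- The indicator of `σ j = s` is absorbed into the factor `j`, so that the sum over profiles still
  -- factorizes.
  have hupd : ∀ σ : ∀ i, S i, ∏ i, Function.update x j (Pi.single s (x j s)) i (σ i)
      = (∏ i, x i (σ i)) * pureProfile σ j s := fun σ => by
    rw [← Finset.mul_prod_erase _ _ (Finset.mem_univ j),
      ← Finset.mul_prod_erase _ (fun i => x i (σ i)) (Finset.mem_univ j), Function.update_self]
    have : ∏ i ∈ Finset.univ.erase j, Function.update x j (Pi.single s (x j s)) i (σ i)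
        = ∏ i ∈ Finset.univ.erase j, x i (σ i) :=
      Finset.prod_congr rfl fun i hi => by
        rw [Function.update_of_ne (Finset.ne_of_mem_erase hi)]
    rw [this]
    by_cases hs : σ j = s
    · simp [pureProfile, hs]
    · simp [pureProfile, hs, Ne.symm hs]
  rw [Finset.sum_apply, Finset.sum_apply]
  simp only [Pi.smul_apply, smul_eq_mul]
  simp_rw [← hupd]
  rw [← Fintype.prod_sum, ← Finset.mul_prod_erase _ _ (Finset.mem_univ j), Function.update_self,
    Finset.prod_eq_one, mul_one]
  · simp
  · intro i hi
    rw [Function.update_of_ne (Finset.ne_of_mem_erase hi)]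
    exact (hx i).2

end Game

/-! ### Drift of the Fenchel coupling -/

section Dynamics

variable {ι : Type*} {S : ι → Type*} [∀ i, Fintype (S i)] {A : ∀ i j, Matrix (S i) (S j) ℝ}
  {xstar : ∀ i, S i → ℝ} {H : ∀ i, (S i → ℝ) → ℝ} {g : ∀ i, (S i → ℝ) → S i → ℝ}

theorem gradient_mem_strategySpace (hH : ∀ i, IsSimplexPotential (H i) (g i))
    (y : ∀ i, S i → ℝ) : (fun i => g i (y i)) ∈ strategySpace S :=
  fun i => (hH i).mem_stdSimplex (y i)

theorem bregman_nonneg (hH : ∀ i, IsSimplexPotential (H i) (g i)) (y v : ∀ i, S i → ℝ) (i : ι) :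
    0 ≤ H i (y i + v i) - (H i (y i) + g i (y i) ⬝ᵥ v i) := by
  have := (hH i).subgradient (y i) (y i + v i)
  rw [add_sub_cancel_left] at this
  linarith

/-- Up to adding constants, the cumulative payoffs at which the reaction is bounded away from the
boundary form a compact set. -/
theorem exists_isCompact_add_const_mem [∀ i, Nonempty (S i)]
    (hH : ∀ i, IsSimplexPotential (H i) (g i)) {ε : ℝ} (hε : 0 < ε) :
    ∃ K : Set (∀ i, S i → ℝ), IsCompact K ∧ (∀ y ∈ K, ∀ i s, ε ≤ g i (y i) s) ∧
      ∀ y : ∀ i, S i → ℝ, (∀ i s, ε ≤ g i (y i) s) → ∃ c : ι → ℝ, (y + fun i _ => c i) ∈ K := by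
  choose R hR using fun i => (hH i).exists_abs_sub_le hε
  have hclosed : IsClosed {y : ∀ i, S i → ℝ | ∀ i s, ε ≤ g i (y i) s} := by
    simp only [Set.ofPred_forall]
    exact isClosed_iInter fun i => isClosed_iInter fun s => isClosed_le continuous_const
      ((continuous_apply s).comp ((hH i).continuous_gradient.comp (continuous_apply i)))
  -- Shifting each agent's payoffs so that one coordinate is zero puts the state in a box of radius
  -- `R i`.
  refine ⟨{y | ∀ i s, ε ≤ g i (y i) s} ∩
      Set.pi Set.univ fun i => Set.pi Set.univ fun _ => Set.Icc (-R i) (R i),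
    (isCompact_univ_pi fun i => isCompact_univ_pi fun _ => isCompact_Icc).inter_left hclosed,
    fun y hy => hy.1, fun y hy => ⟨fun i => -y i (Classical.arbitrary (S i)),
      fun i s => ?_, fun i _ s _ => ?_⟩⟩
  · rw [Pi.add_apply, (hH i).gradient_add_const]
    exact hy i s
  · exact Set.mem_Icc.2 (abs_le.1 (hR i (y i) (hy i) s _))

variable [Fintype ι]

/-- The probability of the pure profile `σ` when the agents react with `g` to the cumulative
payoffs `y`. -/
def profileProb (g : ∀ i, (S i → ℝ) → S i → ℝ) (y : ∀ i, S i → ℝ) (σ : ∀ i, S i) : ℝ :=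
  ∏ i, g i (y i) (σ i)

/-- The total Fenchel coupling between the cumulative payoffs `y` and the profile `xstar`, up to a
constant. -/
def fenchelCoupling (H : ∀ i, (S i → ℝ) → ℝ) (xstar y : ∀ i, S i → ℝ) : ℝ :=
  ∑ i, (H i (y i) - xstar i ⬝ᵥ y i)

theorem profileProb_pos (hH : ∀ i, IsSimplexPotential (H i) (g i)) (y : ∀ i, S i → ℝ)
    (σ : ∀ i, S i) : 0 < profileProb g y σ :=
  Finset.prod_pos fun i _ => (hH i).pos _ _

theorem continuous_profileProb (hH : ∀ i, IsSimplexPotential (H i) (g i)) (σ : ∀ i, S i) :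
    Continuous fun y => profileProb g y σ :=
  continuous_finsetProd _ fun i _ => (continuous_apply (σ i)).comp
    ((hH i).continuous_gradient.comp (continuous_apply i))

theorem continuous_fenchelCoupling (hH : ∀ i, IsSimplexPotential (H i) (g i)) :
    Continuous (fenchelCoupling H xstar) :=
  continuous_finsetSum _ fun i _ => ((hH i).continuous.comp (continuous_apply i)).sub
    (Continuous.dotProduct continuous_const (continuous_apply i))

theorem fenchelCoupling_add_const (hH : ∀ i, IsSimplexPotential (H i) (g i))
    (hx : xstar ∈ strategySpace S) (y : ∀ i, S i → ℝ) (c : ι → ℝ) :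
    fenchelCoupling H xstar (y + fun i _ => c i) = fenchelCoupling H xstar y := by
  refine Finset.sum_congr rfl fun i _ => ?_
  rw [Pi.add_apply, (hH i).add_const, dotProduct_comm (xstar i),
    dotProduct_add_const_of_mem_stdSimplex (hx i), dotProduct_comm]
  ring

theorem abs_fenchelCoupling_add_sub_le (hH : ∀ i, IsSimplexPotential (H i) (g i))
    (hx : xstar ∈ strategySpace S) (y v : ∀ i, S i → ℝ) :
    |fenchelCoupling H xstar (y + v) - fenchelCoupling H xstar y| ≤ ∑ i, (‖v i‖ + ‖v i‖) := by
  simp only [fenchelCoupling, ← Finset.sum_sub_distrib]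
  refine (Finset.abs_sum_le_sum_abs _ _).trans (Finset.sum_le_sum fun i _ => ?_)
  have h1 := (hH i).abs_sub_le (y i) (y i + v i)
  rw [add_sub_cancel_left] at h1
  have h2 := abs_dotProduct_le_of_mem_stdSimplex (hx i) (v i)
  rw [Pi.add_apply, dotProduct_add, show H i (y i + v i) - (xstar i ⬝ᵥ y i + xstar i ⬝ᵥ v i)
    - (H i (y i) - xstar i ⬝ᵥ y i) = (H i (y i + v i) - H i (y i)) - xstar i ⬝ᵥ v i by ring]
  exact (abs_sub _ _).trans (add_le_add h1 h2)

variable [DecidableEq ι]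

theorem sum_profileProb (hH : ∀ i, IsSimplexPotential (H i) (g i)) (y : ∀ i, S i → ℝ) :
    ∑ σ, profileProb g y σ = 1 :=
  sum_prod_eq_one (gradient_mem_strategySpace hH y)

variable [∀ i, DecidableEq (S i)]

/-- The payoff vectors of all agents at a pure profile. -/
def payoffStep (A : ∀ i j, Matrix (S i) (S j) ℝ) (σ : ∀ i, S i) :
    ∀ i, S i → ℝ :=
  fun i => payoff A i (pureProfile σ)

/-- The one-step drift of the Fenchel coupling is an average of Bregman divergences. -/
theorem transition_fenchelCoupling_sub (hA : IsZeroSum A) (hN : IsNash A xstar)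
    (hpos : ∀ i s, 0 < xstar i s) (hH : ∀ i, IsSimplexPotential (H i) (g i))
    (y : ∀ i, S i → ℝ) :
    (transition (profileProb g) (payoffStep A) (fenchelCoupling H xstar)
        - fenchelCoupling H xstar) y
      = ∑ σ, profileProb g y σ * ∑ i, (H i (y i + payoffStep A σ i)
          - (H i (y i) + g i (y i) ⬝ᵥ payoffStep A σ i)) := by
  have hx := gradient_mem_strategySpace hH y
  -- The mean step is the payoff against the current reaction, so the first-order part of the drift
  -- vanishes.
  have hmean : ∑ σ, profileProb g y σ * ∑ i, (g i (y i) - xstar i) ⬝ᵥ payoffStep A σ i = 0 := by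
    rw [← hA.sum_sub_dotProduct_payoff_eq_zero hN hpos hx]
    simp only [Finset.mul_sum]
    rw [Finset.sum_comm]
    refine Finset.sum_congr rfl fun i _ => ?_
    have h := payoff_sum_smul (A := A) i (profileProb g y) pureProfile
    rw [show ∑ σ, profileProb g y σ • pureProfile σ = fun i => g i (y i) from
      sum_prod_smul_pureProfile hx] at h
    rw [h, dotProduct_sum]
    exact Finset.sum_congr rfl fun σ _ => by rw [dotProduct_smul, smul_eq_mul]; rfl
  have hF : fenchelCoupling H xstar y
      = ∑ σ, profileProb g y σ * fenchelCoupling H xstar y := by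
    rw [← Finset.sum_mul, sum_profileProb hH, one_mul]
  rw [Pi.sub_apply, transition_apply, hF, ← Finset.sum_sub_distrib, ← sub_zero (∑ σ, _), ← hmean,
    ← Finset.sum_sub_distrib]
  refine Finset.sum_congr rfl fun σ _ => ?_
  rw [← mul_sub, ← mul_sub]
  congr 1
  simp only [fenchelCoupling, ← Finset.sum_sub_distrib]
  refine Finset.sum_congr rfl fun i _ => ?_
  rw [Pi.add_apply, dotProduct_add, sub_dotProduct]
  ring

theorem transition_fenchelCoupling_sub_nonneg (hA : IsZeroSum A) (hN : IsNash A xstar)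
    (hpos : ∀ i s, 0 < xstar i s) (hH : ∀ i, IsSimplexPotential (H i) (g i))
    (y : ∀ i, S i → ℝ) :
    0 ≤ (transition (profileProb g) (payoffStep A) (fenchelCoupling H xstar)
        - fenchelCoupling H xstar) y := by
  rw [transition_fenchelCoupling_sub hA hN hpos hH]
  exact Finset.sum_nonneg fun σ _ => mul_nonneg (profileProb_pos hH y σ).le
    (Finset.sum_nonneg fun i _ => bregman_nonneg hH y _ i)

theorem transition_pow_drift_nonneg (hA : IsZeroSum A) (hN : IsNash A xstar)
    (hpos : ∀ i s, 0 < xstar i s) (hH : ∀ i, IsSimplexPotential (H i) (g i)) (k : ℕ)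
    (y : ∀ i, S i → ℝ) :
    0 ≤ (transition (profileProb g) (payoffStep A) ^ k)
      (transition (profileProb g) (payoffStep A) (fenchelCoupling H xstar)
        - fenchelCoupling H xstar) y := by
  have := transition_pow_mono (w := profileProb g) (Δ := payoffStep A)
    (fun y σ => (profileProb_pos hH y σ).le) k (f := 0)
    (transition_fenchelCoupling_sub_nonneg hA hN hpos hH) y
  simpa using this

/-- Where the drift vanishes, the reaction is the same after any step. -/
theorem gradient_eq_of_drift_eq_zero (hA : IsZeroSum A) (hN : IsNash A xstar)
    (hpos : ∀ i s, 0 < xstar i s) (hH : ∀ i, IsSimplexPotential (H i) (g i))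
    {y : ∀ i, S i → ℝ}
    (h : (transition (profileProb g) (payoffStep A) (fenchelCoupling H xstar)
        - fenchelCoupling H xstar) y = 0) (σ : ∀ i, S i) (i : ι) :
    g i (y i + payoffStep A σ i) = g i (y i) := by
  rw [transition_fenchelCoupling_sub hA hN hpos hH, Finset.sum_eq_zero_iff_of_nonneg fun σ _ =>
    mul_nonneg (profileProb_pos hH y σ).le
      (Finset.sum_nonneg fun i _ => bregman_nonneg hH y _ i)] at h
  have h1 := (mul_eq_zero.1 (h σ (Finset.mem_univ σ))).resolve_left (profileProb_pos hH y σ).ne'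
  rw [Finset.sum_eq_zero_iff_of_nonneg fun i _ => bregman_nonneg hH y _ i] at h1
  exact (hH i).gradient_eq_of_affine (sub_eq_zero.1 (h1 i (Finset.mem_univ i)))

/-- After sufficiently many steps the drift of the Fenchel coupling is positive wherever the
reaction is bounded away from the boundary. -/
theorem exists_transition_pow_drift_pos (hA : IsZeroSum A) (hnt : IsNontrivial A)
    (hN : IsNash A xstar) (hpos : ∀ i s, 0 < xstar i s)
    (hH : ∀ i, IsSimplexPotential (H i) (g i)) {ε : ℝ} (hε : 0 < ε) :
    ∃ n : ℕ, ∀ y : ∀ i, S i → ℝ, (∀ i s, ε ≤ g i (y i) s) →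
      0 < (transition (profileProb g) (payoffStep A) ^ n) (fenchelCoupling H xstar) y
        - fenchelCoupling H xstar y := by
  -- If all payoff vectors were constant, so would be their differences.
  obtain ⟨i, σ, s, s', hss⟩ : ∃ (i : ι) (σ : ∀ j, S j) (s s' : S i),
      payoffStep A σ i s ≠ payoffStep A σ i s' := by
    by_contra! hcon
    obtain ⟨i, σ, σ', h⟩ := hnt
    refine h (payoffStep A σ i (σ i) - payoffStep A σ' i (σ i)) (funext fun s => ?_)
    rw [Pi.sub_apply, hcon i σ (σ i) s, hcon i σ' (σ i) s]
    rfl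
  obtain ⟨R, hR⟩ := (hH i).exists_abs_sub_le hε
  have hd : 0 < |payoffStep A σ i s - payoffStep A σ i s'| := abs_pos.2 (sub_ne_zero.2 hss)
  -- After `n` repetitions of `σ` the gap between `s` and `s'` has changed by more than `2 * R`,
  -- although it would be at most `R` at both ends.
  obtain ⟨n, hn⟩ := exists_nat_gt (2 * R / |payoffStep A σ i s - payoffStep A σ i s'|)
  rw [div_lt_iff₀ hd] at hn
  refine ⟨n, fun y hy => ?_⟩
  rw [transition_pow_sub_eq_sum]
  have hnonneg := fun k => transition_pow_drift_nonneg hA hN hpos hH k y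
  refine (Finset.sum_nonneg fun k _ => hnonneg k).lt_of_ne' fun hzero => ?_
  rw [Finset.sum_eq_zero_iff_of_nonneg fun k _ => hnonneg k] at hzero
  have hconst : ∀ k ≤ n, g i (y i + k • payoffStep A σ i) = g i (y i) := by
    intro k hk
    induction k with
    | zero => simp
    | succ k ih =>
      have h1 := eq_zero_of_transition_pow_eq_zero (profileProb_pos hH)
        (transition_fenchelCoupling_sub_nonneg hA hN hpos hH) σ k y
        (hzero k (Finset.mem_range.2 hk))
      have h2 := gradient_eq_of_drift_eq_zero hA hN hpos hH h1 σ i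
      rw [← ih (by omega), succ_nsmul, ← add_assoc]
      exact h2
  have h1 := hR (y i) (hy i) s s'
  have h2 := hR (y i + n • payoffStep A σ i)
    (fun r => by rw [hconst n le_rfl]; exact hy i r) s s'
  have h3 : (n : ℝ) * |payoffStep A σ i s - payoffStep A σ i s'|
      ≤ |(y i + n • payoffStep A σ i) s - (y i + n • payoffStep A σ i) s'| + |y i s - y i s'| := by
    rw [← Nat.abs_cast n, ← abs_mul]
    refine le_trans (le_of_eq ?_) (abs_sub _ _)
    congr 1
    simp
    ring
  linarith

theorem continuous_transition_pow (hH : ∀ i, IsSimplexPotential (H i) (g i))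
    {F : (∀ i, S i → ℝ) → ℝ} (hF : Continuous F) (n : ℕ) :
    Continuous ((transition (profileProb g) (payoffStep A) ^ n) F) := by
  induction n with
  | zero => simpa using hF
  | succ n ih =>
    have : (transition (profileProb g) (payoffStep A) ^ (n + 1)) F = fun y => ∑ σ,
        profileProb g y σ * (transition (profileProb g) (payoffStep A) ^ n) F
          (y + payoffStep A σ) := funext fun y => transition_pow_succ_apply n F y
    rw [this]
    exact continuous_finsetSum _ fun σ _ => (continuous_profileProb hH σ).mul
      (ih.comp (continuous_add_const _))

/-- The reactions, hence the transition probabilities, ignore added constants. This lets the drift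
bound on a compact set of representatives hold at all states they represent. -/
theorem transition_pow_add_const (hH : ∀ i, IsSimplexPotential (H i) (g i))
    {F : (∀ i, S i → ℝ) → ℝ} {c : ι → ℝ} (hF : ∀ y, F (y + fun i _ => c i) = F y) (n : ℕ)
    (y : ∀ i, S i → ℝ) :
    (transition (profileProb g) (payoffStep A) ^ n) F (y + fun i _ => c i)
      = (transition (profileProb g) (payoffStep A) ^ n) F y := by
  induction n generalizing y with
  | zero => simpa using hF y
  | succ n ih =>
    rw [transition_pow_succ_apply, transition_pow_succ_apply]
    refine Finset.sum_congr rfl fun σ _ => ?_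
    rw [add_right_comm, ih]
    congr 1
    exact Finset.prod_congr rfl fun i _ => by rw [Pi.add_apply, (hH i).gradient_add_const]

end Dynamics

/-! ### Passage to compact sets of profiles and conclusion -/

theorem exists_pos_le_of_isCompact_subset_fullyMixed {ι : Type*} [Fintype ι] {S : ι → Type*}
    [∀ i, Fintype (S i)] {B : Set (∀ i, S i → ℝ)} (hB : IsCompact B) (hsub : B ⊆ fullyMixed S) :
    ∃ ε > 0, ∀ x ∈ B, ∀ i s, ε ≤ x i s := by
  choose e he hle using fun p : Σ i, S i => hB.exists_forall_le' (f := fun x => x p.1 p.2)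
    (by fun_prop) fun x hx => (hsub hx).2 p.1 p.2
  rcases isEmpty_or_nonempty (Σ i, S i) with hemp | hne
  · exact ⟨1, one_pos, fun x _ i s => (hemp.false ⟨i, s⟩).elim⟩
  · obtain ⟨p, -, hp⟩ := Finset.exists_min_image Finset.univ e Finset.univ_nonempty
    exact ⟨e p, he p, fun x hx i s => (hp ⟨i, s⟩ (Finset.mem_univ _)).trans (hle ⟨i, s⟩ x hx)⟩

end NetworkGame

/-- The realized reactions spend asymptotically no time in a compact set of fully mixed profiles.
The Fenchel coupling with the equilibrium is a submartingale whose drift over several steps is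
bounded below on the set. Neither the rationality of the equilibrium nor the strict convexity of
the regularizers is needed: the differentiability of the conjugates suffices. -/
theorem mainTheorem3 {ι : Type*} [Fintype ι] [DecidableEq ι] {S : ι → Type*}
    [∀ i, Fintype (S i)] [∀ i, DecidableEq (S i)]
    (A : ∀ i j, Matrix (S i) (S j) ℝ)
    (hzero : NetworkGame.IsZeroSum A) (hnontriv : NetworkGame.IsNontrivial A)
    (hNash : ∃ xstar : ∀ i, S i → ℝ, NetworkGame.IsNash A xstar ∧
      xstar ∈ NetworkGame.fullyMixed S ∧ ∀ i s, ∃ q : ℚ, xstar i s = (q : ℝ))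
    (h : ∀ i, (S i → ℝ) → ℝ) (hconv : ∀ i, StrictConvexOn ℝ (stdSimplex ℝ (S i)) (h i))
    (hgrad : ∀ i, NetworkGame.GradConjugatePos (h i))
    (η : ι → ℝ) (hη : ∀ i, 0 < η i)
    {Ω : Type*} {m : MeasurableSpace Ω} (μ : Measure Ω) [IsProbabilityMeasure μ]
    (ℱ : Filtration ℕ m) (y₀ : ∀ i, S i → ℝ)
    (act : ℕ → Ω → ∀ i, S i) (Y X : ℕ → Ω → ∀ i, S i → ℝ)
    (hFTRL : NetworkGame.IsStochasticFTRL μ ℱ A h η y₀ act Y X)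
    (B : Set (∀ i, S i → ℝ)) (hBcompact : IsCompact B) (hB : B ⊆ NetworkGame.fullyMixed S) :
    ∀ᵐ ω ∂μ, Tendsto (fun T : ℕ => NetworkGame.visitFraction B (fun t => X t ω) T)
      atTop (𝓝 0) := by
  open NetworkGame in
  obtain ⟨xstar, hN, hfull, -⟩ := hNash
  have hne : ∀ i, Nonempty (S i) := fun i => ⟨hnontriv.choose_spec.choose i⟩
  set H : ∀ i, (S i → ℝ) → ℝ := fun i y => conjugate (h i) (η i • y) / η i
  set g : ∀ i, (S i → ℝ) → S i → ℝ := fun i y s =>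
    fderiv ℝ (conjugate (h i)) (η i • y) (Pi.single s 1)
  have hH : ∀ i, IsSimplexPotential (H i) (g i) := fun i =>
    (isSimplexPotential_conjugate (hgrad i)).scale (hη i)
  have hX : ∀ t ω i, X t ω i = g i (Y t ω i) := fun t ω i =>
    eq_gradient_conjugate_of_isMaxOn (hgrad i) (hη i) (hFTRL.mem_simplex t ω i)
      (hFTRL.isMaxOn t ω i)
  obtain ⟨ε, hε, hBε⟩ := exists_pos_le_of_isCompact_subset_fullyMixed hBcompact hB
  obtain ⟨n, hn⟩ := exists_transition_pow_drift_pos hzero hnontriv hN hfull.2 hH hε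
  have hFcont : Continuous (fenchelCoupling H xstar) := continuous_fenchelCoupling hH
  have hFinv := fenchelCoupling_add_const hH hN.1
  obtain ⟨K, hK, hKε, hKmem⟩ := exists_isCompact_add_const_mem hH hε
  -- Compactness upgrades the pointwise positive `n`-step drift to a uniform bound.
  obtain ⟨δ, hδ, hδle⟩ := hK.exists_forall_le'
    ((continuous_transition_pow (A := A) hH hFcont n).sub hFcont).continuousOn
    fun y hy => hn y (hKε y hy)
  obtain ⟨M, hM⟩ := hK.exists_bound_of_continuousOn hFcont.continuousOn
  have hdrift : ∀ y, fenchelCoupling H xstar y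
      ≤ (transition (profileProb g) (payoffStep A) ^ n) (fenchelCoupling H xstar) y := fun y => by
    rw [← sub_nonneg, transition_pow_sub_eq_sum]
    exact Finset.sum_nonneg fun k _ => transition_pow_drift_nonneg hzero hN hfull.2 hH k y
  have hmain := ae_tendsto_visitFraction_chain (μ := μ) (ℱ := ℱ) (y₀ := y₀) (act := act) (Y := Y)
    (fun y σ => (profileProb_pos hH y σ).le) (sum_profileProb hH) hFTRL.measurable_act
    hFTRL.initial (fun t ω => funext fun i => hFTRL.update t ω i)
    (fun t σ => by
      filter_upwards [hFTRL.cond_law t σ] with ω hω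
      rw [hω]
      exact Finset.prod_congr rfl fun i _ => by rw [hX])
    (F := fenchelCoupling H xstar)
    (L := ∑ σ, ∑ i, (‖payoffStep A σ i‖ + ‖payoffStep A σ i‖))
    (fun y σ => (abs_fenchelCoupling_add_sub_le hH hN.1 y (payoffStep A σ)).trans
      (Finset.single_le_sum (f := fun σ => ∑ i, (‖payoffStep A σ i‖ + ‖payoffStep A σ i‖))
        (fun σ _ => by positivity) (Finset.mem_univ σ)))
    hdrift (U := {y | ∀ i s, ε ≤ g i (y i) s}) hδ (M := M)
    (fun y hy => by
      obtain ⟨c, hc⟩ := hKmem y hy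
      rw [← hFinv y c]
      exact hM _ hc)
    (fun y hy => by
      obtain ⟨c, hc⟩ := hKmem y hy
      have hle := hδle _ hc
      rwa [Pi.sub_apply, hFinv, transition_pow_add_const hH fun y => hFinv y c] at hle)
  filter_upwards [hmain] with ω hω
  -- A visit of `X` to `B` forces `Y` into the set where the reaction is at least `ε`, so the visits
  -- of `Y` dominate.
  refine squeeze_zero (fun T => ?_) (fun T => ?_) hω
  · exact div_nonneg (Finset.sum_nonneg fun t _ =>
      Set.indicator_nonneg (fun _ _ => zero_le_one) _) (by positivity)
  · refine div_le_div_of_nonneg_right (Finset.sum_le_sum fun t _ => ?_) (by positivity)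
    by_cases ht : X t ω ∈ B
    · have hmem : Y t ω ∈ {y : ∀ i, S i → ℝ | ∀ i s, ε ≤ g i (y i) s} := fun i s => by
        rw [← hX]
        exact hBε _ ht i s
      rw [Set.indicator_of_mem ht, Set.indicator_of_mem hmem]
    · rw [Set.indicator_of_notMem ht]
      exact Set.indicator_nonneg (fun _ _ => zero_le_one) _
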